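/- Let $A$ be a von Neumann algebra on a complex Hilbert space and let $a\in A$ be self-adjoint. Let $\mathcal C$ be the poset of abelian von Neumann subalgebras of $A$ (with the same unit), ordered by inclusion. The spectral presheaf $\underline\Sigma:\mathcal C^{op}\to\mathbf{Set}$ sends $C$ to its Gelfand spectrum $\Sigma_C$ (nonzero multiplicative linear functionals, weak-$*$ topology), and sends $D\subseteq C$ to the restriction $\lambda\mapsto\lambda|_D$. Let $\underline{\mathbb R}_l(C)$, respectively $\underline{\mathbb R}_u(C)$, be the set of order-reversing, respectively order-preserving, functions $\downarrow C\to\mathbb R$, with restriction of functions; these are the presheaves of lower and upper reals. For self-adjoint $b$ let $(e^b_x)_{x\in\mathbb R}$ be its spectral resolution ($e^b_x$ is the spectral projection for $(-\infty,x]$), and write $b\leq_s c$ iff $e^b_x\geq e^c_x$ for all $x\in\mathbb R$. For $C\in\mathcal C$ put $$\delta^o(a)_C=\bigwedge\{b\in C_{sa}\mid b\geq_s a\},\qquad \delta^i(a)_C=\bigvee\{b\in C_{sa}\mid b\leq_s a\},$$ the greatest lower bound and least upper bound being taken in the self-adjoint part $C_{sa}$ with its usual order. For a presheaf $\underline X$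 on $\mathcal C$ with underlying set $X=\coprod_C\underline X(C)$ and projection $\pi:X\to\mathcal C$, the étale topology on $X$ has as open sets the subsets that are stable under restriction. Give $\mathcal C$ the topology of down-sets. A $\pi$-topology on $X$ is a topology coarser than the étale topology for which $\pi$ is continuous. It describes a topology on $\underline X$ internal to $[\mathcal C^{op},\mathbf{Set}]$, namely the subobject $\mathcal O\underline X$ of the power object $\mathcal P\underline X$ whose elements at stage $C$ are the open sets contained in $\pi^{-1}(\downarrow C)$. An arrow $f:\underline X\to\underline Y$ is a continuous map of internal spaces if $\Vdash\forall U\in\mathcal P\underline Y\,(U\in\mathcal O\underline Y\Rightarrow f^{-1}(U)\in\mathcal O\underline X)$. Give $\underline\Sigma$ the topology generated by the clopen subobjects (the subobjects $\underline S\subseteq\underline\Sigma$ with every $\underline S(C)$ clopen in $\Sigma_C$); give $\underline{\mathbb R}_l$ the topology generated by the sets $\{(D,s)\mid D\subseteq C,\ s(D)>x\}$, and $\underline{\mathbb R}_u$ the topology generated by the sets $\{(D,r)\mid D\subseteq C,\ r(D)<x\}$, for $C\in\mathcal C$, $x\in\mathbb R$. Then: 1. For every $C\in\mathcal C$ the greatest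 lower bound $\delta^o(a)_C$ exists. The formula $\underline{\delta^o(a)}_C(\lambda)(D)=\langle\lambda,\delta^o(a)_D\rangle$ (for $\lambda\in\Sigma_C$, $D\subseteq C$) defines a natural transformation $\underline{\delta^o(a)}:\underline\Sigma\to\underline{\mathbb R}_l$. It is a continuous map of internal topological spaces; externally, the induced map of underlying sets $\coprod_C\Sigma_C\to\coprod_C\underline{\mathbb R}_l(C)$ is continuous for the generated topologies. 2. For every $C\in\mathcal C$ the least upper bound $\delta^i(a)_C$ exists. The formula $\underline{\delta^i(a)}_C(\lambda)(D)=\langle\lambda,\delta^i(a)_D\rangle$ defines a natural transformation $\underline{\delta^i(a)}:\underline\Sigma\to\underline{\mathbb R}_u$. It is a continuous map of internal topological spaces; externally, the induced map $\coprod_C\Sigma_C\to\coprod_C\underline{\mathbb R}_u(C)$ is continuous for the generated topologies. -/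

import Mathlib

open CategoryTheory Opposite Topology

universe u v w

namespace SpectralTopos

/-! ## Internal topological spaces in a presheaf topos over a poset -/

section Internal

variable {P : Type v} [Preorder P]

/-- The underlying set `∐_C X(C)` of the etale bundle of a presheaf `X` on the poset `P`. -/
@[ext]
structure Total (X : Pᵒᵖ ⥤ Type w) where
  base : P
  pt : X.obj (op base)

/-- The restriction `x|_D` of an element `x ∈ X(C)` along `D ≤ C`. -/
def restr (X : Pᵒᵖ ⥤ Type w) {C D : P} (h : D ≤ C) (x : X.obj (op C)) : X.obj (op D) :=
  X.map (homOfLE h).op x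

/-- A subset of the bundle that is stable under restriction: a subobject of the presheaf. -/
def IsStable (X : Pᵒᵖ ⥤ Type w) (U : Set (Total X)) : Prop :=
  ∀ (C : P) (x : X.obj (op C)), (⟨C, x⟩ : Total X) ∈ U →
    ∀ (D : P) (h : D ≤ C), (⟨D, restr X h x⟩ : Total X) ∈ U

/-- The etale topology: the open sets are the restriction-stable sets. -/
abbrev etaleTopology (X : Pᵒᵖ ⥤ Type w) : TopologicalSpace (Total X) where
  IsOpen U := IsStable X U
  isOpen_univ := fun _ _ _ _ _ => trivial
  isOpen_inter := fun _ _ hU hV C x hx D h => ⟨hU C x hx.1 D h, hV C x hx.2 D h⟩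
  isOpen_sUnion := by
    rintro S hS C x ⟨U, hU, hx⟩ D h
    exact ⟨U, hU, hS U hU C x hx D h⟩

/-- The elements at stage `C` of the power object of `X`: subobjects of `X × y(C)`. As `y(C)(D)`
is a singleton if `D ≤ C` and empty otherwise, these are the restriction-stable subsets of the
bundle that live over the down-set of `C`. -/
@[ext]
structure PowAt (X : Pᵒᵖ ⥤ Type w) (C : P) where
  carrier : Set (Total X)
  stable : IsStable X carrier
  base_le : ∀ y ∈ carrier, y.base ≤ C

/-- Restriction in the power object: pullback along `X × y(D) → X × y(C)`. -/
def PowAt.restrict {X : Pᵒᵖ ⥤ Type w} {C : P} (U : PowAt X C) (D : P) : PowAt X D where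
  carrier := {y | y ∈ U.carrier ∧ y.base ≤ D}
  stable := fun E x hx F h => ⟨U.stable E x hx.1 F h, h.trans hx.2⟩
  base_le := fun _ hy => hy.2

/-- The power object `𝒫X` of a presheaf `X`. -/
def Pow (X : Pᵒᵖ ⥤ Type w) : Pᵒᵖ ⥤ Type (max v w) where
  obj C := PowAt X C.unop
  map {_ D} _ := TypeCat.ofHom fun U => U.restrict D.unop
  map_id C := by
    ext U y
    exact ⟨fun h => h.1, fun h => ⟨h, U.base_le y h⟩⟩
  map_comp {C D E} f g := by
    ext U y
    exact ⟨fun h => ⟨⟨h.1, h.2.trans (leOfHom g.unop)⟩, h.2⟩, fun h => ⟨h.1.1, h.2⟩⟩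

/-- The whole of `X`, as an element of `𝒫X` at stage `C`. -/
def PowAt.whole (X : Pᵒᵖ ⥤ Type w) (C : P) : PowAt X C where
  carrier := {y | y.base ≤ C}
  stable := fun _ _ hx _ h => h.trans hx
  base_le := fun _ hy => hy

/-- The empty subobject, as an element of `𝒫X` at stage `C`. -/
def PowAt.empty (X : Pᵒᵖ ⥤ Type w) (C : P) : PowAt X C where
  carrier := ∅
  stable := fun _ _ hx => hx.elim
  base_le := fun _ hy => hy.elim

/-- Binary intersection `𝒫X × 𝒫X → 𝒫X`. -/
def PowAt.inter {X : Pᵒᵖ ⥤ Type w} {C : P} (U V : PowAt X C) : PowAt X C where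
  carrier := U.carrier ∩ V.carrier
  stable := fun D x hx E h => ⟨U.stable D x hx.1 E h, V.stable D x hx.2 E h⟩
  base_le := fun y hy => U.base_le y hy.1

/-- Union `⋃ : 𝒫𝒫X → 𝒫X`. By presheaf semantics `D ⊩ x ∈ ⋃ Y` means that there is an element `U`
of `𝒫X` at stage `D` with `D ⊩ U ∈ Y` and `D ⊩ x ∈ U`. -/
def PowAt.union {X : Pᵒᵖ ⥤ Type w} {C : P} (Y : PowAt (Pow X) C) : PowAt X C where
  carrier := {y | ∃ U : PowAt X y.base, (⟨y.base, U⟩ : Total (Pow X)) ∈ Y.carrier ∧ y ∈ U.carrier}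
  stable := by
    rintro D x ⟨U, hU, hx⟩ E h
    exact ⟨U.restrict E, Y.stable D U hU E h, U.stable D x hx E h, le_rfl⟩
  base_le := by
    rintro y ⟨U, hU, -⟩
    exact Y.base_le _ hU

/-- A topology on `X` internal to the presheaf topos: a subobject `𝒪X ⊆ 𝒫X` such that
`⊩ X ∈ 𝒪X ∧ ∅ ∈ 𝒪X ∧ (U, V ∈ 𝒪X → U ∩ V ∈ 𝒪X) ∧ (Y ⊆ 𝒪X → ⋃ Y ∈ 𝒪X)`,
spelled out by presheaf semantics. -/
structure InternalTopology (X : Pᵒᵖ ⥤ Type w) where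
  opens : Subfunctor (Pow X)
  whole_mem : ∀ C : P, PowAt.whole X C ∈ opens.obj (op C)
  empty_mem : ∀ C : P, PowAt.empty X C ∈ opens.obj (op C)
  inter_mem : ∀ (C : P) (U V : PowAt X C),
    U ∈ opens.obj (op C) → V ∈ opens.obj (op C) → U.inter V ∈ opens.obj (op C)
  union_mem : ∀ (C : P) (Y : PowAt (Pow X) C),
    (∀ y ∈ Y.carrier, y.pt ∈ opens.obj (op y.base)) → Y.union ∈ opens.obj (op C)

/-- The map of bundles over `P` induced by a natural transformation. -/
def totalMap {X Y : Pᵒᵖ ⥤ Type w} (f : X ⟶ Y) (y : Total X) : Total Y :=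
  ⟨y.base, f.app (op y.base) y.pt⟩

/-- The inverse image `f⁻¹ : 𝒫Y → 𝒫X` along an arrow `f : X → Y`, at stage `C`. -/
def PowAt.preimage {X Y : Pᵒᵖ ⥤ Type w} (f : X ⟶ Y) {C : P} (U : PowAt Y C) : PowAt X C where
  carrier := totalMap f ⁻¹' U.carrier
  stable := by
    intro D x hx E h
    have h1 := U.stable D (f.app (op D) x) hx E h
    have h2 : f.app (op E) (restr X h x) = restr Y h (f.app (op D) x) :=
      NatTrans.naturality_apply f (homOfLE h).op x
    change (⟨E, f.app (op E) (restr X h x)⟩ : Total Y) ∈ U.carrier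
    rw [h2]
    exact h1
  base_le := fun _ hy => U.base_le _ hy

/-- Internal continuity of an arrow `f : X → Y`:
`⊩ ∀ U ∈ 𝒫Y, U ∈ 𝒪Y → f⁻¹(U) ∈ 𝒪X`, spelled out by presheaf semantics. -/
def InternallyContinuous {X Y : Pᵒᵖ ⥤ Type w} (OX : InternalTopology X) (OY : InternalTopology Y)
    (f : X ⟶ Y) : Prop :=
  ∀ (C : P) (U : PowAt Y C), U ∈ OY.opens.obj (op C) → U.preimage f ∈ OX.opens.obj (op C)

/-- A `π`-topology on the bundle of `X`: a topology coarser than the etale topology for which the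
projection `π` to `P` with the down-set (Alexandroff) topology is continuous. -/
structure PiTopology (X : Pᵒᵖ ⥤ Type w) where
  top : TopologicalSpace (Total X)
  coarser : etaleTopology X ≤ top
  continuous_proj : @Continuous _ _ top (Topology.lowerSet P) Total.base

theorem PiTopology.isOpen_over {X : Pᵒᵖ ⥤ Type w} (T : PiTopology X) (C : P) :
    IsOpen[T.top] {y : Total X | y.base ≤ C} := by
  let := T.top
  let := Topology.lowerSet P
  have h : IsOpen[Topology.lowerSet P] (Set.Iic C) := isLowerSet_Iic C
  exact h.preimage T.continuous_proj

/-- The internal topology described by a `π`-topology: at stage `C`, the internal opens are the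
open sets of the `π`-topology that live over the down-set of `C`. -/
def PiTopology.toInternal {X : Pᵒᵖ ⥤ Type w} (T : PiTopology X) : InternalTopology X where
  opens :=
    { obj := fun C => {U : PowAt X C.unop | IsOpen[T.top] U.carrier}
      map := fun {C D} i U hU => by
        let := T.top
        exact IsOpen.inter hU (T.isOpen_over D.unop) }
  whole_mem C := T.isOpen_over C
  empty_mem C := by
    let := T.top
    exact isOpen_empty
  inter_mem C U V hU hV := by
    let := T.top
    exact IsOpen.inter hU hV
  union_mem C Y hY := by
    let := T.top
    have h : Y.union.carrier = ⋃ y ∈ Y.carrier, PowAt.carrier y.pt := by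
      ext x
      simp only [PowAt.union, Set.mem_ofPred_eq, Set.mem_iUnion]
      constructor
      · rintro ⟨U, hU, hx⟩
        exact ⟨_, hU, hx⟩
      · rintro ⟨⟨D, U⟩, hU, hx⟩
        have hle : x.base ≤ D := PowAt.base_le U x hx
        exact ⟨PowAt.restrict U x.base, Y.stable D U hU x.base hle, hx, le_rfl⟩
    change IsOpen Y.union.carrier
    rw [h]
    exact isOpen_biUnion fun y hy => hY y hy

/-! ### The lower and upper reals -/

/-- The presheaf of lower reals, `C ↦ OR(↓C, ℝ)` (order-reversing functions). -/
def LowerReals (P : Type v) [Preorder P] : Pᵒᵖ ⥤ Type v where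
  obj C := {s : Set.Iic C.unop → ℝ // Antitone s}
  map {_ _} i := TypeCat.ofHom fun s =>
    ⟨fun E => s.1 ⟨E.1, E.2.trans (leOfHom i.unop)⟩, fun _ _ h => s.2 h⟩
  map_id _ := rfl
  map_comp _ _ := rfl

/-- The presheaf of upper reals, `C ↦ OP(↓C, ℝ)` (order-preserving functions). -/
def UpperReals (P : Type v) [Preorder P] : Pᵒᵖ ⥤ Type v where
  obj C := {r : Set.Iic C.unop → ℝ // Monotone r}
  map {_ _} i := TypeCat.ofHom fun r =>
    ⟨fun E => r.1 ⟨E.1, E.2.trans (leOfHom i.unop)⟩, fun _ _ h => r.2 h⟩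
  map_id _ := rfl
  map_comp _ _ := rfl

/-- The value at the stage `C` itself of a lower real at stage `C`. -/
def lowerVal (y : Total (LowerReals P)) : ℝ := y.pt.1 ⟨y.base, le_rfl⟩

/-- The value at the stage `C` itself of an upper real at stage `C`. -/
def upperVal (y : Total (UpperReals P)) : ℝ := y.pt.1 ⟨y.base, le_rfl⟩

/-- The natural topology of the lower reals, generated by the sets
`{(D, s) | D ≤ C, s(D) > x}` for `C ∈ P` and `x ∈ ℝ`. -/
def lowerPi (P : Type v) [Preorder P] : PiTopology (LowerReals P) where
  top := TopologicalSpace.generateFrom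
    {U | ∃ (C : P) (x : ℝ), U = {y | y.base ≤ C ∧ x < lowerVal y}}
  coarser := by
    refine le_generateFrom ?_
    rintro _ ⟨C, x, rfl⟩ D s hs E h
    exact ⟨h.trans hs.1, lt_of_lt_of_le hs.2 (s.2 h)⟩
  continuous_proj := by
    let := Topology.lowerSet P
    refine @Continuous.mk _ _ (_) _ _ fun S hS => ?_
    have h : Total.base ⁻¹' S =
        ⋃ C ∈ S, ⋃ x : ℝ, {y : Total (LowerReals P) | y.base ≤ C ∧ x < lowerVal y} := by
      ext y
      simp only [Set.mem_preimage, Set.mem_iUnion, Set.mem_ofPred_eq]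
      constructor
      · intro hy
        exact ⟨y.base, hy, lowerVal y - 1, le_rfl, by linarith⟩
      · rintro ⟨C, hC, x, hy, -⟩
        exact (hS : IsLowerSet S) hy hC
    rw [h]
    let : TopologicalSpace (Total (LowerReals P)) := TopologicalSpace.generateFrom
      {U | ∃ (C : P) (x : ℝ), U = {y | y.base ≤ C ∧ x < lowerVal y}}
    exact isOpen_biUnion fun C _ => isOpen_iUnion fun x =>
      TopologicalSpace.isOpen_generateFrom_of_mem ⟨C, x, rfl⟩

/-- The natural topology of the upper reals, generated by the sets
`{(D, r) | D ≤ C, r(D) < x}` for `C ∈ P` and `x ∈ ℝ`. -/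
def upperPi (P : Type v) [Preorder P] : PiTopology (UpperReals P) where
  top := TopologicalSpace.generateFrom
    {U | ∃ (C : P) (x : ℝ), U = {y | y.base ≤ C ∧ upperVal y < x}}
  coarser := by
    refine le_generateFrom ?_
    rintro _ ⟨C, x, rfl⟩ D s hs E h
    exact ⟨h.trans hs.1, lt_of_le_of_lt (s.2 h) hs.2⟩
  continuous_proj := by
    let := Topology.lowerSet P
    refine @Continuous.mk _ _ (_) _ _ fun S hS => ?_
    have h : Total.base ⁻¹' S =
        ⋃ C ∈ S, ⋃ x : ℝ, {y : Total (UpperReals P) | y.base ≤ C ∧ upperVal y < x} := by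
      ext y
      simp only [Set.mem_preimage, Set.mem_iUnion, Set.mem_ofPred_eq]
      constructor
      · intro hy
        exact ⟨y.base, hy, upperVal y + 1, le_rfl, by linarith⟩
      · rintro ⟨C, hC, x, hy, -⟩
        exact (hS : IsLowerSet S) hy hC
    rw [h]
    let : TopologicalSpace (Total (UpperReals P)) := TopologicalSpace.generateFrom
      {U | ∃ (C : P) (x : ℝ), U = {y | y.base ≤ C ∧ upperVal y < x}}
    exact isOpen_biUnion fun C _ => isOpen_iUnion fun x =>
      TopologicalSpace.isOpen_generateFrom_of_mem ⟨C, x, rfl⟩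

end Internal

/-! ## Contexts, the spectral presheaf and daseinisation -/

section Quantum

variable {H : Type u} [NormedAddCommGroup H] [InnerProductSpace ℂ H] [CompleteSpace H]

/-- The contexts of a von Neumann algebra `A`: its abelian von Neumann subalgebras. -/
structure Context (A : VonNeumannAlgebra H) where
  alg : VonNeumannAlgebra H
  le : alg ≤ A
  comm : ∀ b ∈ alg, ∀ c ∈ alg, b * c = c * b

variable {A : VonNeumannAlgebra H}

/-- Contexts are ordered by inclusion. -/
instance : PartialOrder (Context A) :=
  PartialOrder.lift Context.alg fun C D h => by cases C; cases D; cases h; rfl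

/-- The inclusion `D ↪ C` of contexts. -/
noncomputable def Context.incl {C D : Context A} (h : D ≤ C) :
    D.alg.toStarSubalgebra →⋆ₐ[ℂ] C.alg.toStarSubalgebra :=
  StarSubalgebra.inclusion (fun _ hx => h hx)

/-- The Gelfand spectrum `Σ_C` of a context: the nonzero multiplicative linear functionals on `C`,
with the weak-* topology. -/
abbrev Context.spectrum (C : Context A) : Type u :=
  WeakDual.characterSpace ℂ C.alg.toStarSubalgebra

theorem Context.isClosed (C : Context A) :
    IsClosed (C.alg.toStarSubalgebra : Set (H →L[ℂ] H)) := by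
  have h : (C.alg.toStarSubalgebra : Set (H →L[ℂ] H)) =
      Set.centralizer (Set.centralizer (C.alg : Set (H →L[ℂ] H))) :=
    (C.alg.centralizer_centralizer).symm
  rw [h]
  exact Set.isClosed_centralizer _

instance (C : Context A) : CompleteSpace C.alg.toStarSubalgebra :=
  C.isClosed.completeSpace_coe

/-- The restriction map `ρ_{CD} : Σ_C → Σ_D`, `λ ↦ λ|_D`. -/
noncomputable def Context.rho {C D : Context A} (h : D ≤ C) : C(C.spectrum, D.spectrum) :=
  WeakDual.CharacterSpace.compContinuousMap (Context.incl h)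

/-- The spectral presheaf `Σ`. -/
noncomputable def SpectralPresheaf (A : VonNeumannAlgebra H) : (Context A)ᵒᵖ ⥤ Type u where
  obj C := C.unop.spectrum
  map i := TypeCat.ofHom (Context.rho (leOfHom i.unop))
  map_id _ := rfl
  map_comp _ _ := rfl

/-- A subobject `S` of the spectral presheaf is clopen if every `S(C) ⊆ Σ_C` is clopen. -/
def IsClopenSubobject (S : Subfunctor (SpectralPresheaf A)) : Prop :=
  ∀ C : Context A, IsClopen (X := C.spectrum) (S.obj (op C))

/-- The subset of the bundle that corresponds to a subobject of the spectral presheaf. -/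
def clopenTotal (S : Subfunctor (SpectralPresheaf A)) : Set (Total (SpectralPresheaf A)) :=
  {y | y.pt ∈ S.obj (op y.base)}

/-- The topology on the spectral presheaf generated by the clopen subobjects. -/
def spectralPi (A : VonNeumannAlgebra H) : PiTopology (SpectralPresheaf A) where
  top := TopologicalSpace.generateFrom
    {U | ∃ S : Subfunctor (SpectralPresheaf A), IsClopenSubobject S ∧ U = clopenTotal S}
  coarser := by
    refine le_generateFrom ?_
    rintro _ ⟨S, -, rfl⟩ D x hx E h
    exact S.map (homOfLE h).op hx
  continuous_proj := by
    let := Topology.lowerSet (Context A)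
    refine @Continuous.mk _ _ (_) _ _ fun V hV => ?_
    refine TopologicalSpace.isOpen_generateFrom_of_mem
      ⟨{ obj := fun C => {_x | C.unop ∈ V}
         map := fun i _ hx => (hV : IsLowerSet V) (leOfHom i.unop) hx }, fun C => ?_, rfl⟩
    exact ⟨isClosed_const (X := C.spectrum) (p := C ∈ V),
      isOpen_const (X := C.spectrum) (p := C ∈ V)⟩

/-- The spectral resolution `(e^a_x)_{x ∈ ℝ}` of a self-adjoint operator `a`: `e^a_x` is
`1` minus the range projection of the positive part `(a - x)⁺`, i.e. the orthogonal projection onto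
the kernel of `(a - x)⁺`. It is the spectral projection of `a` for `(-∞, x]`. -/
noncomputable def spectralResolution (a : H →L[ℂ] H) (x : ℝ) : H →L[ℂ] H :=
  (((a - algebraMap ℝ (H →L[ℂ] H) x)⁺).ker).starProjection

/-- The spectral order: `a ≤ₛ b` iff `e^a_x ≥ e^b_x` for all real `x`. -/
def SpectralLE (a b : H →L[ℂ] H) : Prop :=
  ∀ x : ℝ, spectralResolution b x ≤ spectralResolution a x

/-- The self-adjoint elements of a context, with the usual (Loewner) operator order. -/
abbrev Context.sa (C : Context A) : Type u :=
  {b : H →L[ℂ] H // b ∈ C.alg ∧ IsSelfAdjoint b}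

/-- The self-adjoint elements of `C` that lie above `a` in the spectral order. -/
def upperApprox (a : H →L[ℂ] H) (C : Context A) : Set C.sa := {b | SpectralLE a b.1}

/-- The self-adjoint elements of `C` that lie below `a` in the spectral order. -/
def lowerApprox (a : H →L[ℂ] H) (C : Context A) : Set C.sa := {b | SpectralLE b.1 a}

open Classical in
/-- Outer daseinisation `δᵒ(a)_C = ⋀ {b ∈ C_sa | b ≥ₛ a}`: the greatest lower bound in `C_sa`
(with a default value `0` if there were none). -/
noncomputable def outerDas (a : H →L[ℂ] H) (C : Context A) : C.sa :=
  if h : ∃ g, IsGLB (upperApprox a C) g then h.choose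
  else ⟨0, zero_mem C.alg, IsSelfAdjoint.zero _⟩

open Classical in
/-- Inner daseinisation `δⁱ(a)_C = ⋁ {b ∈ C_sa | b ≤ₛ a}`: the least upper bound in `C_sa`
(with a default value `0` if there were none). -/
noncomputable def innerDas (a : H →L[ℂ] H) (C : Context A) : C.sa :=
  if h : ∃ g, IsLUB (lowerApprox a C) g then h.choose
  else ⟨0, zero_mem C.alg, IsSelfAdjoint.zero _⟩

/-- The pairing `⟨l, b⟩` of `l ∈ Σ_C` with a self-adjoint element `b` of a context `D ≤ C`. -/
noncomputable def pairing {C D : Context A} (h : D ≤ C) (l : C.spectrum) (b : D.sa) : ℂ :=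
  l (⟨b.1, h b.2.1⟩ : C.alg.toStarSubalgebra)

end Quantum

end SpectralTopos

open SpectralTopos

namespace SpectralTopos

/-! ### Strong limits of operators, functional calculus and the spectral order -/

section Operators

open Filter ContinuousLinearMap
open scoped InnerProductSpace ComplexOrder

variable {H : Type u} [NormedAddCommGroup H] [InnerProductSpace ℂ H] [CompleteSpace H]

/-! Write `(b - x)⁺` for `cut b x`. Since `e^b_x` projects onto the kernel of `(b - x)⁺`, the
relation `a ≤ₛ b` says that `ker (b - x)⁺ ⊆ ker (a - x)⁺` for all `x`. The main point is that the
self-adjoint elements of a context `C` spectrally above `a` have a least element for the usual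
order. They include `‖a‖`, are bounded below by `-‖a‖` (as negation reverses the spectral order),
and are closed under binary minima because `C` is abelian (`SpectralLE.of_inf`) and under decreasing
strong limits (`SpectralLE.of_tendsto`). The net of those below `‖a‖` thus converges strongly to a
least one, which lies in `C` by the double commutant property.

So the infimum is attained: `δᵒ(a)_D` is itself a competitor in every `C ⊇ D`, whence `δᵒ(a)_C ≤
δᵒ(a)_D`, which is the required monotonicity.

For continuity, `λ(δᵒ(a)_D) > x` is witnessed by some `z > x` at which `λ` kills the spectral
projection of `δᵒ(a)_D` for `(-∞, z]`. Characters take only the values `0` and `1` on projections,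
so this condition is clopen; it survives restriction because `δᵒ(a)` grows as the context shrinks
(`isOpen_setOf_lt_val`). Internal continuity is then formal, and the inner case follows by negation.
-/

theorem norm_apply_sq_le_of_nonneg {T : H →L[ℂ] H} (hT : 0 ≤ T) (v : H) :
    ‖T v‖ ^ 2 ≤ ‖T‖ * T.reApplyInnerSelf v := by
  obtain ⟨s, hs⟩ := CStarAlgebra.nonneg_iff_eq_star_mul_self.mp hT
  have h1 : T v = (star s) (s v) := by rw [hs]; rfl
  have h2 : ‖T‖ = ‖s‖ * ‖s‖ := by rw [hs, CStarRing.norm_star_mul_self]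
  have h3 : T.reApplyInnerSelf v = ‖s v‖ ^ 2 := by
    rw [reApplyInnerSelf_apply, h1, star_eq_adjoint, adjoint_inner_left, inner_self_eq_norm_sq]
  have h4 : ‖T v‖ ≤ ‖s‖ * ‖s v‖ := by
    rw [h1, ← norm_star s]
    exact (star s).le_opNorm _
  rw [h2, h3]
  calc ‖T v‖ ^ 2 ≤ (‖s‖ * ‖s v‖) ^ 2 := by gcongr
    _ = _ := by ring

omit [CompleteSpace H] in
theorem reApplyInnerSelf_sub (S T : H →L[ℂ] H) (v : H) :
    (S - T).reApplyInnerSelf v = S.reApplyInnerSelf v - T.reApplyInnerSelf v := by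
  simp [reApplyInnerSelf_apply, inner_sub_left]

omit [CompleteSpace H] in
theorem reApplyInnerSelf_mono {S T : H →L[ℂ] H} (h : S ≤ T) (v : H) :
    S.reApplyInnerSelf v ≤ T.reApplyInnerSelf v := by
  have := ((le_def S T).mp h).2 v
  rw [reApplyInnerSelf_sub] at this
  linarith

omit [CompleteSpace H] in
theorem abs_reApplyInnerSelf_le (T : H →L[ℂ] H) (v : H) :
    |T.reApplyInnerSelf v| ≤ ‖T‖ * ‖v‖ ^ 2 := by
  rw [reApplyInnerSelf_apply]
  calc |RCLike.re ⟪T v, v⟫_ℂ| ≤ ‖⟪T v, v⟫_ℂ‖ := RCLike.abs_re_le_norm _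
    _ ≤ ‖T v‖ * ‖v‖ := norm_inner_le_norm _ _
    _ ≤ (‖T‖ * ‖v‖) * ‖v‖ := by gcongr; exact T.le_opNorm v
    _ = _ := by ring

/-- Bounded monotone nets of operators converge strongly. -/
theorem exists_tendsto_atBot_of_monotone {ι : Type*} [Preorder ι] [Nonempty ι]
    [IsCodirectedOrder ι] {b : ι → H →L[ℂ] H} (hb : Monotone b) {R : ℝ} (hR : ∀ i, ‖b i‖ ≤ R) :
    ∃ g : H →L[ℂ] H, ∀ v, Tendsto (fun i => b i v) atBot (𝓝 (g v)) := by
  have key : ∀ v, ∃ w, Tendsto (fun i => b i v) atBot (𝓝 w) := by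
    intro v
    have hR0 : 0 ≤ R := (norm_nonneg _).trans (hR (Classical.arbitrary ι))
    have hmono : Monotone fun i => (b i).reApplyInnerSelf v :=
      fun i j h => reApplyInnerSelf_mono (hb h) v
    have hbdd : BddBelow (Set.range fun i => (b i).reApplyInnerSelf v) := by
      refine ⟨-(R * ‖v‖ ^ 2), ?_⟩
      rintro _ ⟨i, rfl⟩
      have h1 := abs_le.mp (abs_reApplyInnerSelf_le (b i) v)
      have h2 : ‖b i‖ * ‖v‖ ^ 2 ≤ R * ‖v‖ ^ 2 := by gcongr; exact hR i
      linarith [h1.1]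
    have hq := tendsto_atBot_ciInf hmono hbdd
    set q := ⨅ i, (b i).reApplyInnerSelf v
    have hle : ∀ i, q ≤ (b i).reApplyInnerSelf v := fun i => ciInf_le hbdd i
    rw [← cauchy_map_iff_exists_tendsto, Metric.cauchy_iff]
    refine ⟨inferInstance, fun ε hε => ?_⟩
    -- With this gap, `‖T v‖² ≤ ‖T‖ ⟪T v, v⟫` for `T = b i - b j` gives `‖T v‖ < ε / 2`; the `+ 1`
    -- covers `R = 0`.
    have hδ : 0 < (ε / 2) ^ 2 / (2 * R + 1) := by positivity
    obtain ⟨i, hi⟩ := (hq.eventually (gt_mem_nhds (lt_add_of_pos_right q hδ))).exists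
    have hclose : ∀ j ≤ i, dist (b j v) (b i v) < ε / 2 := by
      intro j hj
      have h0 : 0 ≤ b i - b j := sub_nonneg.mpr (hb hj)
      have h1 := norm_apply_sq_le_of_nonneg h0 v
      have h2 : ‖b i - b j‖ ≤ 2 * R + 1 :=
        (norm_sub_le _ _).trans (by linarith [hR i, hR j])
      have h3 : (b i - b j).reApplyInnerSelf v < (ε / 2) ^ 2 / (2 * R + 1) := by
        rw [reApplyInnerSelf_sub]
        linarith [hle j]
      have h4 : 0 ≤ (b i - b j).reApplyInnerSelf v := ((nonneg_iff_isPositive _).mp h0).2 v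
      have h5 : ‖(b i - b j) v‖ ^ 2 < (ε / 2) ^ 2 := by
        calc _ ≤ _ := h1
          _ ≤ (2 * R + 1) * (b i - b j).reApplyInnerSelf v := by gcongr
          _ < (2 * R + 1) * ((ε / 2) ^ 2 / (2 * R + 1)) := by gcongr
          _ = _ := by field_simp
      rw [dist_comm, dist_eq_norm, ← sub_apply]
      exact lt_of_pow_lt_pow_left₀ 2 (by positivity) h5
    refine ⟨_, image_mem_map (Iic_mem_atBot i), ?_⟩
    rintro _ ⟨j, hj, rfl⟩ _ ⟨k, hk, rfl⟩
    calc dist (b j v) (b k v) ≤ dist (b j v) (b i v) + dist (b k v) (b i v) :=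
          dist_triangle_right _ _ _
      _ < ε := by linarith [hclose j hj, hclose k hk]
  choose f hf using key
  refine ⟨ofTendstoOfBoundedRange (l := atBot) f b (tendsto_pi_nhds.mpr hf) ?_, hf⟩
  refine isBounded_iff_forall_norm_le.mpr ⟨R, ?_⟩
  rintro _ ⟨i, rfl⟩
  exact hR i

omit [CompleteSpace H] in
/-- The order of operators is closed under strong limits. -/
theorem le_of_tendsto_apply {ι : Type*} {l : Filter ι} [l.NeBot] {S T : ι → H →L[ℂ] H}
    {S' T' : H →L[ℂ] H} (hS : ∀ v, Tendsto (fun i => S i v) l (𝓝 (S' v)))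
    (hT : ∀ v, Tendsto (fun i => T i v) l (𝓝 (T' v))) (h : ∀ᶠ i in l, S i ≤ T i) : S' ≤ T' := by
  -- Over `ℂ` a form with real nonnegative values is already symmetric, so self-adjointness of the
  -- limit need not be checked.
  refine (le_def _ _).mpr ((isPositive_iff_complex _).mpr fun v => ?_)
  have hpos : ∀ᶠ i in l, 0 ≤ ⟪(T i - S i) v, v⟫_ℂ := by
    filter_upwards [h] with i hi
    exact ((le_def _ _).mp hi).inner_nonneg_left v
  have hlim : Tendsto (fun i => ⟪(T i - S i) v, v⟫_ℂ) l (𝓝 ⟪(T' - S') v, v⟫_ℂ) := by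
    simp only [sub_apply]
    exact ((hT v).sub (hS v)).inner tendsto_const_nhds
  have h0 : 0 ≤ ⟪(T' - S') v, v⟫_ℂ := ge_of_tendsto hlim hpos
  rw [RCLike.nonneg_iff] at h0
  refine ⟨?_, h0.1⟩
  rw [← RCLike.re_add_im (K := ℂ) ⟪(T' - S') v, v⟫_ℂ, h0.2]
  simp

/-- The positive part of `b - x`. -/
noncomputable def cut (b : H →L[ℂ] H) (x : ℝ) : H →L[ℂ] H := (b - algebraMap ℝ (H →L[ℂ] H) x)⁺

theorem isSelfAdjoint_sub_algebraMap {b : H →L[ℂ] H} (hb : IsSelfAdjoint b) (x : ℝ) :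
    IsSelfAdjoint (b - algebraMap ℝ (H →L[ℂ] H) x) :=
  hb.sub (IsSelfAdjoint.algebraMap _ (.all x))

theorem cut_nonneg (b : H →L[ℂ] H) (x : ℝ) : 0 ≤ cut b x := CFC.posPart_nonneg _

/-- Projections are ordered as their ranges, here the kernels of the cuts. -/
theorem spectralLE_iff {a b : H →L[ℂ] H} :
    SpectralLE a b ↔ ∀ x v, cut b x v = 0 → cut a x v = 0 := by
  unfold SpectralLE spectralResolution
  simp only [Submodule.starProjection_le_starProjection_iff, SetLike.le_def]
  rfl

theorem sub_algebraMap_eq_cfc {b : H →L[ℂ] H} (hb : IsSelfAdjoint b) (x : ℝ) :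
    b - algebraMap ℝ (H →L[ℂ] H) x = cfc (fun t : ℝ => t - x) b := by
  rw [cfc_sub (fun t : ℝ => t) (fun _ => x) b, cfc_id' ℝ b, cfc_const x b]

theorem cut_eq_cfc {b : H →L[ℂ] H} (hb : IsSelfAdjoint b) (x : ℝ) :
    cut b x = cfc (fun t : ℝ => max (t - x) 0) b := by
  rw [cut, CFC.posPart_def, cfcₙ_eq_cfc, sub_algebraMap_eq_cfc hb,
    ← cfc_comp' (fun t : ℝ => t⁺) (fun t : ℝ => t - x) b]
  rfl

theorem cut_neg_eq_cfc {b : H →L[ℂ] H} (hb : IsSelfAdjoint b) (x : ℝ) :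
    cut (-b) (-x) = cfc (fun t : ℝ => max (x - t) 0) b := by
  have h : -b - algebraMap ℝ (H →L[ℂ] H) (-x) = cfc (fun t : ℝ => x - t) b := by
    rw [map_neg, sub_neg_eq_add, neg_add_eq_sub, cfc_sub (fun _ => x) (fun t : ℝ => t) b,
      cfc_id' ℝ b, cfc_const x b]
  rw [cut, CFC.posPart_def, cfcₙ_eq_cfc, h,
    ← cfc_comp' (fun t : ℝ => t⁺) (fun t : ℝ => x - t) b]
  rfl

/-- A continuous function of `b` that interpolates between `0` on `(-∞, x]` and `1` on
`[y, ∞)`. -/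
theorem exists_ramp {b : H →L[ℂ] H} (hb : IsSelfAdjoint b) {x y : ℝ} (hxy : x < y) :
    ∃ f k k' : H →L[ℂ] H, IsSelfAdjoint f ∧ f = k * cut b x ∧ 1 - f = k' * cut (-b) (-y) ∧
      cut b y * (1 - f) = 0 ∧ ‖k‖ ≤ (y - x)⁻¹ := by
  have hd : 0 < y - x := sub_pos.mpr hxy
  -- The ramp is `(t - x)⁺ / max (y - x) (t - x)`, its complement `(y - t)⁺ / max (y - x) (y - t)`.
  -- Both denominators are at least `y - x`, which gives continuity and the bound on `k`.
  have hk : Continuous fun t : ℝ => (max (y - x) (t - x))⁻¹ :=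
    Continuous.inv₀ (by fun_prop) fun t => (lt_max_of_lt_left hd).ne'
  have hk' : Continuous fun t : ℝ => (max (y - x) (y - t))⁻¹ :=
    Continuous.inv₀ (by fun_prop) fun t => (lt_max_of_lt_left hd).ne'
  have h1 : (1 : H →L[ℂ] H) - cfc (fun t : ℝ => (max (y - x) (t - x))⁻¹ * max (t - x) 0) b =
      cfc (fun t : ℝ => (max (y - x) (y - t))⁻¹ * max (y - t) 0) b := by
    rw [← cfc_one ℝ b, ← cfc_sub _ _ b (by fun_prop) (by fun_prop)]
    congr 1
    ext t
    rcases le_total t x with h | h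
    · rw [max_eq_right (sub_nonpos.mpr h), max_eq_right (by linarith : y - x ≤ y - t),
        max_eq_left (by linarith : (0 : ℝ) ≤ y - t), inv_mul_cancel₀ (by linarith)]
      simp
    · rcases le_total t y with h' | h'
      · rw [max_eq_left (sub_nonneg.mpr h), max_eq_left (by linarith : y - t ≤ y - x),
          max_eq_left (by linarith : (0 : ℝ) ≤ y - t), max_eq_left (by linarith : t - x ≤ y - x)]
        simp only [Pi.one_apply]
        field_simp
        ring
      · rw [max_eq_left (sub_nonneg.mpr h), max_eq_right (by linarith : y - t ≤ 0),
          max_eq_right (by linarith : y - x ≤ t - x), inv_mul_cancel₀ (by linarith)]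
        simp
  refine ⟨cfc (fun t : ℝ => (max (y - x) (t - x))⁻¹ * max (t - x) 0) b,
    cfc (fun t : ℝ => (max (y - x) (t - x))⁻¹) b, cfc (fun t : ℝ => (max (y - x) (y - t))⁻¹) b,
    cfc_predicate _ _, ?_, ?_, ?_, ?_⟩
  · rw [cut_eq_cfc hb, ← cfc_mul _ _ b hk.continuousOn (by fun_prop)]
  · rw [cut_neg_eq_cfc hb, h1, ← cfc_mul _ _ b hk'.continuousOn (by fun_prop)]
  · rw [h1, cut_eq_cfc hb, ← cfc_mul _ _ b (by fun_prop) (by fun_prop), ← cfc_zero ℝ b]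
    congr 1
    ext t
    rcases le_total t y with h | h
    · simp [max_eq_right (sub_nonpos.mpr h)]
    · simp [max_eq_right (sub_nonpos.mpr h)]
  · refine norm_cfc_le (by positivity) fun t _ => ?_
    rw [norm_inv, Real.norm_of_nonneg (le_max_of_le_left hd.le)]
    exact inv_anti₀ hd (le_max_left _ _)

theorem continuous_cut {b : H →L[ℂ] H} (hb : IsSelfAdjoint b) : Continuous (cut b) := by
  refine (LipschitzWith.of_dist_le_mul (K := 1) fun x y => ?_).continuous
  rw [dist_eq_norm, cut_eq_cfc hb, cut_eq_cfc hb, ← cfc_sub _ _ b, NNReal.coe_one, one_mul]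
  refine norm_cfc_le dist_nonneg fun t _ => ?_
  rw [Real.norm_eq_abs, Real.dist_eq]
  have := abs_max_sub_max_le_abs (t - x) (t - y) 0
  rwa [sub_sub_sub_cancel_left, abs_sub_comm y x] at this

/-- Right continuity of the spectral resolution: it recovers the level `x` from arguments with
ramps, which need a gap `x < y`. -/
theorem cut_apply_eq_zero_of_forall_lt {b : H →L[ℂ] H} (hb : IsSelfAdjoint b) {x : ℝ} {v : H}
    (h : ∀ y, x < y → cut b y v = 0) : cut b x v = 0 := by
  have h1 : Tendsto (fun y => cut b y v) (𝓝[>] x) (𝓝 (cut b x v)) :=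
    (((continuous_cut hb).clm_apply continuous_const).tendsto x).mono_left nhdsWithin_le_nhds
  exact tendsto_nhds_unique h1 <| tendsto_const_nhds.congr' <| by
    filter_upwards [self_mem_nhdsWithin] with y hy using (h y hy).symm

theorem cut_mul_cut_neg (b : H →L[ℂ] H) (x : ℝ) : cut b x * cut (-b) (-x) = 0 := by
  have h : cut (-b) (-x) = (b - algebraMap ℝ (H →L[ℂ] H) x)⁻ := by
    rw [cut, ← CFC.posPart_neg, map_neg]
    congr 1
    abel
  rw [h, cut, CFC.posPart_mul_negPart]

/-- Negation reverses the spectral order. -/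
theorem SpectralLE.neg {a b : H →L[ℂ] H} (ha : IsSelfAdjoint a) (hb : IsSelfAdjoint b)
    (h : SpectralLE a b) : SpectralLE (-b) (-a) := by
  rw [spectralLE_iff] at h ⊢
  intro x v hv
  refine cut_apply_eq_zero_of_forall_lt hb.neg fun y hxy => ?_
  -- The ramp of `a` from `-y` to `-x` fixes `v`. It kills the range of `(-b - y)⁺`, since that
  -- range lies in `ker (b + y)⁺ ⊆ ker (a + y)⁺`. Being self-adjoint, it makes `v` orthogonal to
  -- that range.
  obtain ⟨f, k, k', hf, hfk, hfk', -, -⟩ := exists_ramp ha (neg_lt_neg hxy)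
  rw [neg_neg] at hfk'
  have hfv : f v = v := by
    have h1 : (1 - f) v = 0 := by rw [hfk', mul_apply_eq_comp, hv, map_zero]
    rw [sub_apply, one_apply_eq_self, sub_eq_zero] at h1
    exact h1.symm
  have hsa : IsSelfAdjoint (cut (-b) y) := .of_nonneg (cut_nonneg _ _)
  refine ext_inner_right ℂ fun u => ?_
  have h2 : cut b (-y) (cut (-b) y u) = 0 := by
    have h3 := cut_mul_cut_neg b (-y)
    rw [neg_neg] at h3
    rw [← mul_apply_eq_comp, h3, zero_apply]
  have h4 : f (cut (-b) y u) = 0 := by rw [hfk, mul_apply_eq_comp, h _ _ h2, map_zero]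
  rw [inner_zero_left]
  calc ⟪cut (-b) y v, u⟫_ℂ = ⟪v, cut (-b) y u⟫_ℂ := hsa.isSymmetric v u
    _ = ⟪f v, cut (-b) y u⟫_ℂ := by rw [hfv]
    _ = ⟪v, f (cut (-b) y u)⟫_ℂ := hf.isSymmetric v _
    _ = 0 := by rw [h4, inner_zero_right]

end Operators

/-! ### Order and cuts in an abelian algebra, read off from its characters -/

section Contexts

open Filter ContinuousLinearMap
open scoped InnerProductSpace ComplexOrder

variable {H : Type u} [NormedAddCommGroup H] [InnerProductSpace ℂ H] [CompleteSpace H]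
variable {A : VonNeumannAlgebra H}

theorem VonNeumannAlgebra.algebraMap_mem (S : VonNeumannAlgebra H) (x : ℝ) :
    algebraMap ℝ (H →L[ℂ] H) x ∈ S :=
  S.toStarSubalgebra.algebraMap_mem (x : ℂ)

theorem VonNeumannAlgebra.mem_of_commute {S : VonNeumannAlgebra H} {T : H →L[ℂ] H}
    (h : ∀ y : H →L[ℂ] H, (∀ b ∈ S, Commute b y) → Commute T y) : T ∈ S := by
  rw [← S.commutant_commutant, VonNeumannAlgebra.mem_commutant_iff]
  intro y hy
  exact (h y (VonNeumannAlgebra.mem_commutant_iff.mp hy)).symm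

theorem VonNeumannAlgebra.cut_mem {S : VonNeumannAlgebra H} {b : H →L[ℂ] H} (hb : b ∈ S)
    (hsa : IsSelfAdjoint b) (x : ℝ) : cut b x ∈ S := by
  refine VonNeumannAlgebra.mem_of_commute fun y hy => ?_
  rw [cut_eq_cfc hsa]
  exact (hy b hb).cfc_real _

/-- The projection onto the kernel of an element of a von Neumann algebra belongs to the
algebra. -/
theorem VonNeumannAlgebra.starProjection_ker_mem {S : VonNeumannAlgebra H} {T : H →L[ℂ] H}
    (hT : T ∈ S) : T.ker.starProjection ∈ S := by
  -- Membership amounts to invariance of the range under the commutant, and operators commuting with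
  -- `T` preserve its kernel.
  rw [VonNeumannAlgebra.IsStarProjection.mem_iff isStarProjection_starProjection]
  intro y hy
  have h := VonNeumannAlgebra.mem_commutant_iff.mp hy T hT
  rw [Submodule.range_starProjection, Module.End.mem_invtSubmodule]
  intro v hv
  have hv' : T v = 0 := hv
  change T (y v) = 0
  rw [← mul_apply_eq_comp, h, mul_apply_eq_comp, hv', map_zero]

namespace Context

variable (C : Context A)

instance : IsClosed (C.alg.toStarSubalgebra : Set (H →L[ℂ] H)) := C.isClosed

noncomputable instance : CommCStarAlgebra C.alg.toStarSubalgebra where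
  __ := StarSubalgebra.cstarAlgebra C.alg.toStarSubalgebra
  mul_comm b c := Subtype.ext (C.comm b.1 b.2 c.1 c.2)

variable {C}

theorem eq_of_forall_apply_eq {S T : C.alg.toStarSubalgebra} (h : ∀ l : C.spectrum, l S = l T) :
    S = T :=
  (gelfandTransform_isometry C.alg.toStarSubalgebra).injective (ContinuousMap.ext h)

theorem apply_re_nonneg (l : C.spectrum) {T : C.alg.toStarSubalgebra}
    (hT : 0 ≤ (T : H →L[ℂ] H)) : 0 ≤ (l T).re := by
  have h1 : l T ∈ _root_.spectrum ℂ (T : H →L[ℂ] H) := by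
    rw [← StarSubalgebra.spectrum_eq]
    exact AlgHom.apply_mem_spectrum l T
  have hsa : IsSelfAdjoint (T : H →L[ℂ] H) := .of_nonneg hT
  rw [hsa.mem_spectrum_eq_re h1] at h1
  exact spectrum_nonneg_of_nonneg hT (spectrum.of_algebraMap_mem ℂ h1)

theorem apply_eq_re (l : C.spectrum) {T : C.alg.toStarSubalgebra}
    (hT : IsSelfAdjoint (T : H →L[ℂ] H)) : l T = (l T).re :=
  hT.mem_spectrum_eq_re <| by
    rw [← StarSubalgebra.spectrum_eq]
    exact AlgHom.apply_mem_spectrum l T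

/-- By Gelfand theory every spectral value in the context is a character value, and the spectrum is
the same in `C` as in all bounded operators. -/
theorem nonneg_of_forall_apply {T : C.alg.toStarSubalgebra} (hsa : IsSelfAdjoint (T : H →L[ℂ] H))
    (h : ∀ l : C.spectrum, 0 ≤ (l T).re) : 0 ≤ (T : H →L[ℂ] H) := by
  rw [StarOrderedRing.nonneg_iff_spectrum_nonneg (R := ℝ) _ hsa]
  intro x hx
  have h1 : (x : ℂ) ∈ _root_.spectrum ℂ T := by
    rw [StarSubalgebra.spectrum_eq]
    exact spectrum.algebraMap_mem ℂ hx
  obtain ⟨l, hl⟩ := WeakDual.CharacterSpace.mem_spectrum_iff_exists.mp h1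
  simpa [hl] using h l

theorem le_of_forall_apply {S T : C.alg.toStarSubalgebra} (hS : IsSelfAdjoint (S : H →L[ℂ] H))
    (hT : IsSelfAdjoint (T : H →L[ℂ] H)) (h : ∀ l : C.spectrum, (l S).re ≤ (l T).re) :
    (S : H →L[ℂ] H) ≤ T := by
  rw [← sub_nonneg]
  refine nonneg_of_forall_apply (T := T - S) (hT.sub hS) fun l => ?_
  rw [map_sub, Complex.sub_re, sub_nonneg]
  exact h l

/-- The value of a character on a self-adjoint element of the context. -/
noncomputable def val (l : C.spectrum) (b : C.sa) : ℝ :=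
  (l (⟨b.1, b.2.1⟩ : C.alg.toStarSubalgebra)).re

theorem coe_val (l : C.spectrum) (b : C.sa) :
    (val l b : ℂ) = l (⟨b.1, b.2.1⟩ : C.alg.toStarSubalgebra) :=
  (apply_eq_re l (T := ⟨b.1, b.2.1⟩) b.2.2).symm

theorem val_mono (l : C.spectrum) {b c : C.sa} (h : b ≤ c) : val l b ≤ val l c := by
  have h0 : (0 : H →L[ℂ] H) ≤ c.1 - b.1 := sub_nonneg.mpr h
  have h1 := apply_re_nonneg l (T := ⟨c.1, c.2.1⟩ - ⟨b.1, b.2.1⟩) h0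
  rw [map_sub, Complex.sub_re, sub_nonneg] at h1
  exact h1

theorem le_of_forall_val {b c : C.sa} (h : ∀ l, val l b ≤ val l c) : b ≤ c :=
  le_of_forall_apply (S := ⟨b.1, b.2.1⟩) (T := ⟨c.1, c.2.1⟩) b.2.2 c.2.2 h

/-- The positive part of `b - x`, as an element of the context. -/
noncomputable def saCut (b : C.sa) (x : ℝ) : C.sa :=
  ⟨cut b.1 x, VonNeumannAlgebra.cut_mem b.2.1 b.2.2 x, .of_nonneg (cut_nonneg _ _)⟩

/-- The positive and negative parts of `b - x` go to nonnegative reals with product `0` and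
difference `val l b - x`, which determines both. -/
theorem val_saCut (l : C.spectrum) (b : C.sa) (x : ℝ) :
    val l (saCut b x) = max (val l b - x) 0 := by
  have hn := CFC.posPart_sub_negPart _ (isSelfAdjoint_sub_algebraMap b.2.2 x)
  have hm := CFC.posPart_mul_negPart (b.1 - algebraMap ℝ (H →L[ℂ] H) x)
  have hneg := CFC.negPart_nonneg (b.1 - algebraMap ℝ (H →L[ℂ] H) x)
  set n := (b.1 - algebraMap ℝ (H →L[ℂ] H) x)⁻
  have hn' : n = cut b.1 x - (b.1 - algebraMap ℝ (H →L[ℂ] H) x) := by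
    rw [← hn, cut]
    abel
  have hmem : n ∈ C.alg := by
    rw [hn']
    exact sub_mem (saCut b x).2.1 (sub_mem b.2.1 (VonNeumannAlgebra.algebraMap_mem _ _))
  let N : C.sa := ⟨n, hmem, .of_nonneg hneg⟩
  have h1 : val l (saCut b x) - val l N = val l b - x := by
    have : (⟨(saCut b x).1, (saCut b x).2.1⟩ : C.alg.toStarSubalgebra) - ⟨N.1, N.2.1⟩ =
        ⟨b.1, b.2.1⟩ - algebraMap ℂ _ (x : ℂ) := Subtype.ext hn
    have h2 := congr((l $this).re)
    rw [map_sub, map_sub, AlgHomClass.commutes] at h2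
    simpa [val] using h2
  have h2 : val l (saCut b x) * val l N = 0 := by
    have : (⟨(saCut b x).1, (saCut b x).2.1⟩ : C.alg.toStarSubalgebra) * ⟨N.1, N.2.1⟩ = 0 :=
      Subtype.ext hm
    have h3 := congr(l $this)
    rw [map_mul, map_zero, ← coe_val, ← coe_val] at h3
    exact_mod_cast h3
  have h3 : 0 ≤ val l (saCut b x) :=
    apply_re_nonneg l (T := ⟨(saCut b x).1, (saCut b x).2.1⟩) (cut_nonneg _ _)
  have h4 : 0 ≤ val l N := apply_re_nonneg l (T := ⟨N.1, N.2.1⟩) hneg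
  rcases mul_eq_zero.mp h2 with h | h
  · rw [h, max_eq_right (by linarith)]
  · rw [max_eq_left (by linarith)]
    linarith

/-- The positive part is not operator monotone in general; in an abelian algebra it can be compared
pointwise on the spectrum. -/
theorem cut_mono {b c : C.sa} (h : b ≤ c) (x : ℝ) : cut b.1 x ≤ cut c.1 x :=
  le_of_forall_val (b := saCut b x) (c := saCut c x) fun l => by
    rw [val_saCut, val_saCut]
    exact max_le_max_right _ (sub_le_sub_right (val_mono l h) _)

/-- The difference of two self-adjoint elements of a context. -/
noncomputable def saSub (b c : C.sa) : C.sa :=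
  ⟨b.1 - c.1, sub_mem b.2.1 c.2.1, b.2.2.sub c.2.2⟩

theorem val_saSub (l : C.spectrum) (b c : C.sa) : val l (saSub b c) = val l b - val l c := by
  rw [val, val, val, ← Complex.sub_re, ← map_sub]
  rfl

theorem cut_sub_cut_le {b c : C.sa} (h : b ≤ c) (x : ℝ) :
    cut c.1 x - cut b.1 x ≤ c.1 - b.1 :=
  le_of_forall_val (b := saSub (saCut c x) (saCut b x)) (c := saSub c b) fun l => by
    rw [val_saSub, val_saSub, val_saCut, val_saCut]
    have := val_mono l h
    rcases le_total (val l b - x) 0 with h1 | h1 <;> rcases le_total (val l c - x) 0 with h2 | h2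
    <;> simp only [max_eq_left, max_eq_right, h1, h2] <;> linarith

/-- The infimum of two self-adjoint elements of a context. -/
theorem exists_inf (b c : C.sa) : ∃ m : C.sa, ∀ l, val l m = min (val l b) (val l c) := by
  -- Pointwise, `min s t = s - (s - t)⁺`.
  refine ⟨saSub b (saCut (saSub b c) 0), fun l => ?_⟩
  rw [val_saSub, val_saCut, val_saSub, sub_zero]
  rcases le_total (val l b) (val l c) with h | h
  · rw [max_eq_right (by linarith), min_eq_left h, sub_zero]
  · rw [max_eq_left (by linarith), min_eq_right h]
    ring

/-- With `M` the pointwise maximum of `b` and `c`, the two cuts are those of `M` and `m` in some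
order at each character. Hence the product kills the kernel of the cut of `m`. -/
theorem cut_mul_cut_eq {b c m : C.sa} (hm : ∀ l, val l m = min (val l b) (val l c)) (x : ℝ) :
    ∃ M : H →L[ℂ] H, cut b.1 x * cut c.1 x = M * cut m.1 x := by
  let M : C.sa := ⟨b.1 + c.1 - m.1, sub_mem (add_mem b.2.1 c.2.1) m.2.1,
    (b.2.2.add c.2.2).sub m.2.2⟩
  have hM : ∀ l, val l M = max (val l b) (val l c) := fun l => by
    have h1 : val l M = val l b + val l c - val l m := by
      simp only [val, ← Complex.sub_re, ← Complex.add_re, ← map_sub, ← map_add]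
      rfl
    rw [h1, hm, ← min_add_max (val l b) (val l c)]
    ring
  refine ⟨cut M.1 x, ?_⟩
  let e : C.sa → C.alg.toStarSubalgebra := fun b => ⟨b.1, b.2.1⟩
  have key : e (saCut b x) * e (saCut c x) = e (saCut M x) * e (saCut m x) := by
    refine eq_of_forall_apply_eq fun l => ?_
    simp only [map_mul, e, ← coe_val, val_saCut, hm, hM]
    norm_cast
    rcases le_total (val l b) (val l c) with h | h
    · rw [max_eq_right h, min_eq_left h, mul_comm]
    · rw [max_eq_left h, min_eq_right h]
  exact congrArg Subtype.val key

end Context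

end Contexts

/-! ### Existence of the daseinisations and their monotonicity in the context -/

section Daseinisation

open Filter ContinuousLinearMap
open scoped InnerProductSpace ComplexOrder

variable {H : Type u} [NormedAddCommGroup H] [InnerProductSpace ℂ H] [CompleteSpace H]
variable {A : VonNeumannAlgebra H}

theorem cut_eq_zero_iff {b : H →L[ℂ] H} (hb : IsSelfAdjoint b) (x : ℝ) :
    cut b x = 0 ↔ b ≤ algebraMap ℝ (H →L[ℂ] H) x := by
  rw [cut, CFC.posPart_eq_zero_iff _ (isSelfAdjoint_sub_algebraMap hb x), sub_nonpos]

theorem SpectralLE.le_algebraMap {a b : H →L[ℂ] H} (h : SpectralLE a b) (ha : IsSelfAdjoint a)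
    (hb : IsSelfAdjoint b) {x : ℝ} (hx : b ≤ algebraMap ℝ (H →L[ℂ] H) x) :
    a ≤ algebraMap ℝ (H →L[ℂ] H) x := by
  rw [← cut_eq_zero_iff hb] at hx
  rw [← cut_eq_zero_iff ha]
  ext v
  exact spectralLE_iff.mp h x v (by rw [hx, zero_apply])

theorem SpectralLE.algebraMap_le {a b : H →L[ℂ] H} (h : SpectralLE a b) (ha : IsSelfAdjoint a)
    (hb : IsSelfAdjoint b) {x : ℝ} (hx : algebraMap ℝ (H →L[ℂ] H) x ≤ a) :
    algebraMap ℝ (H →L[ℂ] H) x ≤ b := by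
  have h1 := (h.neg ha hb).le_algebraMap hb.neg ha.neg (x := -x)
    (by rw [map_neg]; exact neg_le_neg hx)
  rw [map_neg] at h1
  exact neg_le_neg_iff.mp h1

/-- Below `r` the cut of the scalar is a nonzero scalar, with trivial kernel; from `r` on the cut of
`a` vanishes. -/
theorem spectralLE_algebraMap {a : H →L[ℂ] H} (ha : IsSelfAdjoint a) {r : ℝ}
    (h : a ≤ algebraMap ℝ (H →L[ℂ] H) r) : SpectralLE a (algebraMap ℝ (H →L[ℂ] H) r) := by
  rw [spectralLE_iff]
  intro x v hv
  rcases le_or_gt r x with hx | hx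
  · rw [(cut_eq_zero_iff ha x).mpr (h.trans (algebraMap_mono _ hx)), zero_apply]
  · rw [cut, ← map_sub, CFC.posPart_algebraMap, posPart_eq_self.mpr (sub_nonneg.mpr hx.le),
      Algebra.algebraMap_eq_smul_one, smul_apply, one_apply_eq_self] at hv
    rw [(smul_eq_zero.mp hv).resolve_left (sub_pos.mpr hx).ne', map_zero]

/-- The spectral order is stable under binary infima in an abelian algebra. -/
theorem SpectralLE.of_inf {C : Context A} {a : H →L[ℂ] H} {b c m : C.sa}
    (hm : ∀ l, Context.val l m = min (Context.val l b) (Context.val l c))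
    (hb : SpectralLE a b.1) (hc : SpectralLE a c.1) : SpectralLE a m.1 := by
  rw [spectralLE_iff] at hb hc ⊢
  intro x v hv
  obtain ⟨M, hM⟩ := Context.cut_mul_cut_eq hm x
  -- Split `v` along the projection `p` onto `ker (b - x)⁺`: `p v` is killed by the cut of `b`, and
  -- `v - p v` by the cut of `c`, because `p` commutes with that cut.
  have h1 : cut b.1 x (cut c.1 x v) = 0 := by
    rw [← mul_apply_eq_comp, hM, mul_apply_eq_comp, hv, map_zero]
  set p := (cut b.1 x).ker.starProjection
  have hp : p ∈ C.alg := VonNeumannAlgebra.starProjection_ker_mem (Context.saCut b x).2.1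
  have h2 : p (cut c.1 x v) = cut c.1 x v := Submodule.starProjection_eq_self_iff.mpr h1
  have hcomm : cut c.1 x * p = p * cut c.1 x := C.comm _ (Context.saCut c x).2.1 _ hp
  have h3 : cut c.1 x (v - p v) = 0 := by
    rw [map_sub, ← mul_apply_eq_comp (cut c.1 x) p, hcomm, mul_apply_eq_comp, h2, sub_self]
  have h4 : cut b.1 x (p v) = 0 :=
    ((cut b.1 x).ker.starProjection_apply_mem v : p v ∈ (cut b.1 x).ker)
  rw [← add_sub_cancel (p v) v, map_add, hb x _ h4, hc x _ h3, add_zero]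

/-- The spectral order is stable under decreasing strong limits in an abelian algebra. -/
theorem SpectralLE.of_tendsto {C : Context A} {ι : Type*} {L : Filter ι} [L.NeBot]
    {a : H →L[ℂ] H} (ha : IsSelfAdjoint a) {b : ι → C.sa} {g d : C.sa} (hd : ∀ i, b i ≤ d)
    (hg : ∀ i, g ≤ b i) (h : ∀ i, SpectralLE a (b i).1)
    (hlim : ∀ v, Tendsto (fun i => (b i).1 v) L (𝓝 (g.1 v))) : SpectralLE a g.1 := by
  rw [spectralLE_iff]
  intro x v hv
  refine cut_apply_eq_zero_of_forall_lt ha fun y hxy => ?_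
  -- As `(g - x)⁺ v = 0`, the form of `(b i - x)⁺` at `v` is at most that of `b i - g`, which tends
  -- to `0`.
  have h1 : ∀ i, ‖cut (b i).1 x v‖ ^ 2 ≤
      ‖cut d.1 x‖ * ((b i).1 - g.1).reApplyInnerSelf v := fun i => by
    have h2 := norm_apply_sq_le_of_nonneg (cut_nonneg (b i).1 x) v
    have h3 : ‖cut (b i).1 x‖ ≤ ‖cut d.1 x‖ :=
      CStarAlgebra.norm_le_norm_of_nonneg_of_le (cut_nonneg _ _) (Context.cut_mono (hd i) x)
    have h4 := reApplyInnerSelf_mono (Context.cut_sub_cut_le (hg i) x) v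
    have h5 : (cut g.1 x).reApplyInnerSelf v = 0 := by simp [reApplyInnerSelf_apply, hv]
    rw [reApplyInnerSelf_sub, h5, sub_zero] at h4
    have h6 : 0 ≤ (cut (b i).1 x).reApplyInnerSelf v :=
      ((nonneg_iff_isPositive _).mp (cut_nonneg (b i).1 x)).2 v
    exact h2.trans (mul_le_mul h3 h4 h6 (norm_nonneg _))
  have h2 : Tendsto (fun i => ((b i).1 - g.1).reApplyInnerSelf v) L (𝓝 0) := by
    have h3 : Tendsto (fun i => ⟪(b i).1 v - g.1 v, v⟫_ℂ) L (𝓝 ⟪g.1 v - g.1 v, v⟫_ℂ) :=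
      ((hlim v).sub tendsto_const_nhds).inner tendsto_const_nhds
    rw [sub_self, inner_zero_left] at h3
    exact (Complex.continuous_re.tendsto 0).comp h3
  have h3 : Tendsto (fun i => ‖cut (b i).1 x v‖) L (𝓝 0) := by
    have h4 : Tendsto (fun i => ‖cut (b i).1 x v‖ ^ 2) L (𝓝 0) :=
      squeeze_zero (fun i => by positivity) h1 (by simpa using h2.const_mul ‖cut d.1 x‖)
    simpa [Function.comp_def] using (Real.continuous_sqrt.tendsto 0).comp h4
  -- For the ramp `f` of `b i` from `x` to `y`, the vector `(1 - f) v` is killed by `(b i - y)⁺`,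
  -- hence by `(a - y)⁺`. Only `f v` contributes, and its norm is controlled by `(b i - x)⁺ v`.
  have h4 : ∀ i, ‖cut a y v‖ ≤ ‖cut a y‖ * ((y - x)⁻¹ * ‖cut (b i).1 x v‖) := fun i => by
    obtain ⟨f, k, k', -, hfk, -, hf, hk⟩ := exists_ramp (b i).2.2 hxy
    have h5 : cut a y ((1 - f) v) = 0 :=
      spectralLE_iff.mp (h i) y _ (by rw [← mul_apply_eq_comp, hf, zero_apply])
    rw [sub_apply, one_apply_eq_self, map_sub, sub_eq_zero] at h5
    rw [h5]
    calc ‖cut a y (f v)‖ ≤ ‖cut a y‖ * ‖f v‖ := le_opNorm _ _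
      _ = ‖cut a y‖ * ‖k (cut (b i).1 x v)‖ := by rw [hfk, mul_apply_eq_comp]
      _ ≤ ‖cut a y‖ * (‖k‖ * ‖cut (b i).1 x v‖) := by gcongr; exact le_opNorm _ _
      _ ≤ _ := by gcongr
  have h5 : ‖cut a y v‖ ≤ 0 :=
    ge_of_tendsto' (by simpa using (h3.const_mul (y - x)⁻¹).const_mul ‖cut a y‖) h4
  exact norm_le_zero_iff.mp h5

/-- Among the self-adjoint elements of a context above `a` in the spectral order there is a
least one. -/
theorem exists_isLeast_upperApprox {a : H →L[ℂ] H} (ha : IsSelfAdjoint a) (C : Context A) :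
    ∃ g, IsLeast (upperApprox a C) g := by
  set r := algebraMap ℝ (H →L[ℂ] H) ‖a‖
  let d : C.sa := ⟨r, VonNeumannAlgebra.algebraMap_mem _ _, IsSelfAdjoint.algebraMap _ (.all _)⟩
  have hd : d ∈ upperApprox a C := spectralLE_algebraMap ha ha.le_algebraMap_norm_self
  have hlow : ∀ b ∈ upperApprox a C, -r ≤ b.1 := fun b hb => by
    have h := hb.algebraMap_le ha b.2.2 (x := -‖a‖)
      (by rw [map_neg]; exact ha.neg_algebraMap_norm_le_self)
    rwa [map_neg] at h
  -- Restricting to approximants below `d` makes the net norm bounded.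
  let ι := {b : C.sa // b ∈ upperApprox a C ∧ b ≤ d}
  have hinf : ∀ b ∈ upperApprox a C, ∀ c ∈ upperApprox a C,
      ∃ m ∈ upperApprox a C, m ≤ b ∧ m ≤ c := fun b hb c hc => by
    obtain ⟨m, hm⟩ := Context.exists_inf b c
    refine ⟨m, SpectralLE.of_inf hm hb hc, ?_, ?_⟩ <;>
    refine Context.le_of_forall_val fun l => ?_ <;> rw [hm]
    exacts [min_le_left _ _, min_le_right _ _]
  have : Nonempty ι := ⟨⟨d, hd, le_rfl⟩⟩
  have : IsCodirectedOrder ι := ⟨fun b c => by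
    obtain ⟨m, hm, hmb, hmc⟩ := hinf b.1 b.2.1 c.1 c.2.1
    exact ⟨⟨m, hm, hmb.trans b.2.2⟩, hmb, hmc⟩⟩
  have hbdd : ∀ b : ι, ‖b.1.1‖ ≤ ‖r + r‖ + ‖r‖ := fun b => by
    have h1 : 0 ≤ b.1.1 + r := neg_le_iff_add_nonneg.mp (hlow _ b.2.1)
    have hbr : b.1.1 ≤ r := b.2.2
    have h2 : ‖b.1.1 + r‖ ≤ ‖r + r‖ :=
      CStarAlgebra.norm_le_norm_of_nonneg_of_le h1 (by gcongr)
    calc ‖b.1.1‖ = ‖(b.1.1 + r) - r‖ := by rw [add_sub_cancel_right]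
      _ ≤ _ := (norm_sub_le _ _).trans (by gcongr)
  obtain ⟨g, hg⟩ := exists_tendsto_atBot_of_monotone (b := fun b : ι => b.1.1)
    (fun b c h => h) hbdd
  have hgb : ∀ b : ι, g ≤ b.1.1 := fun b =>
    le_of_tendsto_apply hg (fun v => tendsto_const_nhds) (Iic_mem_atBot b)
  have hgsa : IsSelfAdjoint g := by
    have h : -r ≤ g := le_of_tendsto_apply (fun v => tendsto_const_nhds) hg
      (Eventually.of_forall fun b => hlow _ b.2.1)
    have h1 := (IsSelfAdjoint.of_nonneg (sub_nonneg.mpr h)).add d.2.2.neg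
    rwa [sub_neg_eq_add, add_neg_cancel_right] at h1
  have hgC : g ∈ C.alg := VonNeumannAlgebra.mem_of_commute fun y hy => by
    ext v
    have h1 : Tendsto (fun b : ι => y (b.1.1 v)) atBot (𝓝 (y (g v))) :=
      (y.continuous.tendsto _).comp (hg v)
    refine tendsto_nhds_unique (hg (y v)) (h1.congr fun b => ?_)
    exact congr($((hy b.1.1 b.1.2.1).eq) v).symm
  refine ⟨⟨g, hgC, hgsa⟩, ?_, fun b hb => ?_⟩
  · exact SpectralLE.of_tendsto (L := atBot) (b := fun b : ι => b.1) ha (fun b => b.2.2) hgb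
      (fun b => b.2.1) hg
  -- An arbitrary approximant need not lie below `d`, but its minimum with `d` does.
  · obtain ⟨m, hm, hmb, hmd⟩ := hinf b hb d hd
    exact (hgb ⟨m, hm, hmd⟩).trans hmb

/-- The infimum is attained, so it is itself spectrally above `a`; this is what allows comparison
between contexts. -/
theorem isLeast_outerDas {a : H →L[ℂ] H} (ha : IsSelfAdjoint a) (C : Context A) :
    IsLeast (upperApprox a C) (outerDas a C) := by
  obtain ⟨g, hg⟩ := exists_isLeast_upperApprox ha C
  have h : ∃ g, IsGLB (upperApprox a C) g := ⟨g, hg.isGLB⟩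
  have h1 : outerDas a C = g := by
    rw [outerDas, dif_pos h]
    exact h.choose_spec.unique hg.isGLB
  rwa [h1]

theorem exists_isGreatest_lowerApprox {a : H →L[ℂ] H} (ha : IsSelfAdjoint a) (C : Context A) :
    ∃ g, IsGreatest (lowerApprox a C) g := by
  obtain ⟨g, hg, hle⟩ := exists_isLeast_upperApprox ha.neg C
  refine ⟨⟨-g.1, neg_mem g.2.1, g.2.2.neg⟩, ?_, fun b hb => ?_⟩
  · have h : SpectralLE (-g.1) (- -a) := SpectralLE.neg ha.neg g.2.2 hg
    rwa [neg_neg] at h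
  · have h : g.1 ≤ -b.1 := hle (a := ⟨-b.1, neg_mem b.2.1, b.2.2.neg⟩) (SpectralLE.neg b.2.2 ha hb)
    exact le_neg_of_le_neg h

theorem isGreatest_innerDas {a : H →L[ℂ] H} (ha : IsSelfAdjoint a) (C : Context A) :
    IsGreatest (lowerApprox a C) (innerDas a C) := by
  obtain ⟨g, hg⟩ := exists_isGreatest_lowerApprox ha C
  have h : ∃ g, IsLUB (lowerApprox a C) g := ⟨g, hg.isLUB⟩
  have h1 : innerDas a C = g := by
    rw [innerDas, dif_pos h]
    exact h.choose_spec.unique hg.isLUB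
  rwa [h1]

/-- The inclusion of the self-adjoint elements of a smaller context. -/
def Context.saIncl {C D : Context A} (h : D ≤ C) (b : D.sa) : C.sa := ⟨b.1, h b.2.1, b.2.2⟩

theorem outerDas_anti {a : H →L[ℂ] H} (ha : IsSelfAdjoint a) {C D : Context A} (h : D ≤ C) :
    (outerDas a C).1 ≤ (outerDas a D).1 :=
  by
  have hmem : Context.saIncl h (outerDas a D) ∈ upperApprox a C := (isLeast_outerDas ha D).1
  exact (isLeast_outerDas ha C).2 hmem

theorem innerDas_mono {a : H →L[ℂ] H} (ha : IsSelfAdjoint a) {C D : Context A} (h : D ≤ C) :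
    (innerDas a D).1 ≤ (innerDas a C).1 :=
  by
  have hmem : Context.saIncl h (innerDas a D) ∈ lowerApprox a C := (isGreatest_innerDas ha D).1
  exact (isGreatest_innerDas ha C).2 hmem

end Daseinisation

/-- Internal opens at a stage are external opens over its down-set, and internal inverse images are
computed on the bundles. -/
theorem internallyContinuous_of_continuous {P : Type v} [Preorder P] {X Y : Pᵒᵖ ⥤ Type w}
    {S : PiTopology X} {T : PiTopology Y} {f : X ⟶ Y}
    (hf : @Continuous _ _ S.top T.top (totalMap f)) :
    InternallyContinuous S.toInternal T.toInternal f := by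
  let := S.top
  let := T.top
  exact fun _ _ hU => IsOpen.preimage hf hU

/-! ### Clopen subobjects from spectral projections, and continuity of the arrows -/

section Continuity

open Filter ContinuousLinearMap
open scoped InnerProductSpace ComplexOrder

variable {H : Type u} [NormedAddCommGroup H] [InnerProductSpace ℂ H] [CompleteSpace H]
variable {A : VonNeumannAlgebra H}

theorem apply_eq_zero_of_le {S T : H →L[ℂ] H} (hS : 0 ≤ S) (h : S ≤ T) {v : H} (hv : T v = 0) :
    S v = 0 := by
  have h1 := norm_apply_sq_le_of_nonneg hS v
  have h2 := reApplyInnerSelf_mono h v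
  have h3 : T.reApplyInnerSelf v = 0 := by simp [reApplyInnerSelf_apply, hv]
  have h4 : ‖S v‖ ^ 2 ≤ 0 :=
    h1.trans (mul_nonpos_of_nonneg_of_nonpos (norm_nonneg _) (h2.trans_eq h3))
  exact norm_eq_zero.mp (pow_eq_zero_iff two_ne_zero |>.mp (le_antisymm h4 (by positivity)))

namespace Context

variable {C D : Context A}

theorem continuous_val (b : C.sa) : Continuous fun l : C.spectrum => val l b :=
  Complex.continuous_re.comp ((WeakDual.eval_continuous _).comp continuous_subtype_val)

theorem val_mul_val {b c d : C.sa} (h : b.1 * c.1 = d.1) (l : C.spectrum) :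
    val l b * val l c = val l d := by
  have h1 : (⟨b.1, b.2.1⟩ : C.alg.toStarSubalgebra) * ⟨c.1, c.2.1⟩ = ⟨d.1, d.2.1⟩ :=
    Subtype.ext h
  have h2 := congr(l $h1)
  rw [map_mul, ← coe_val, ← coe_val, ← coe_val] at h2
  exact_mod_cast h2

theorem val_zero (l : C.spectrum) {b : C.sa} (h : b.1 = 0) : val l b = 0 := by
  have h1 : (⟨b.1, b.2.1⟩ : C.alg.toStarSubalgebra) = 0 := Subtype.ext h
  rw [val, h1, map_zero, Complex.zero_re]

theorem val_neg (l : C.spectrum) {b c : C.sa} (h : c.1 = -b.1) : val l c = -val l b := by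
  have h1 : (⟨c.1, c.2.1⟩ : C.alg.toStarSubalgebra) = -⟨b.1, b.2.1⟩ := Subtype.ext h
  rw [val, h1, map_neg, Complex.neg_re, val]

/-- The spectral projection of `b` for `(-∞, x]`, as an element of the context. -/
noncomputable def saResolution (b : C.sa) (x : ℝ) : C.sa :=
  ⟨spectralResolution b.1 x, VonNeumannAlgebra.starProjection_ker_mem (saCut b x).2.1,
    isStarProjection_starProjection.isSelfAdjoint⟩

theorem val_saResolution_eq (l : C.spectrum) (b : C.sa) (x : ℝ) :
    val l (saResolution b x) = 0 ∨ val l (saResolution b x) = 1 := by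
  have h := val_mul_val (b := saResolution b x) (c := saResolution b x) (d := saResolution b x)
    isStarProjection_starProjection.isIdempotentElem l
  grind

theorem val_saResolution_eq_zero_of_lt {l : C.spectrum} {b : C.sa} {x : ℝ} (h : x < val l b) :
    val l (saResolution b x) = 0 := by
  have h1 : (saCut b x).1 * (saResolution b x).1 = 0 := by
    ext v
    exact ((cut b.1 x).ker.starProjection_apply_mem v : _ ∈ (cut b.1 x).ker)
  let z : C.sa := ⟨0, zero_mem C.alg, IsSelfAdjoint.zero _⟩
  have h2 := val_mul_val (d := z) h1 l
  rw [val_zero l (b := z) rfl, val_saCut, max_eq_left (by linarith)] at h2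
  exact (mul_eq_zero.mp h2).resolve_left (by linarith)

/-- The projection acts as the identity on `(b - x)⁻`, so a character killing it kills `(b - x)⁻`.
-/
theorem le_val_of_val_saResolution_eq_zero {l : C.spectrum} {b : C.sa} {x : ℝ}
    (h : val l (saResolution b x) = 0) : x ≤ val l b := by
  let n : C.sa := ⟨-b.1, neg_mem b.2.1, b.2.2.neg⟩
  have h1 : (saResolution b x).1 * (saCut n (-x)).1 = (saCut n (-x)).1 := by
    ext v
    refine Submodule.starProjection_eq_self_iff.mpr ?_
    change cut b.1 x (cut (-b.1) (-x) v) = 0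
    rw [← mul_apply_eq_comp, cut_mul_cut_neg, zero_apply]
  have h2 := val_mul_val h1 l
  rw [h, zero_mul, val_saCut, val_neg l (b := b) (c := n) rfl] at h2
  have h3 := le_max_left (-val l b - -x) 0
  linarith

theorem saResolution_anti {b c : C.sa} (h : b ≤ c) (x : ℝ) :
    saResolution c x ≤ saResolution b x :=
  Submodule.starProjection_le_starProjection_iff.mpr fun _ hv =>
    apply_eq_zero_of_le (cut_nonneg _ _) (cut_mono h x) hv

theorem isClopen_setOf_val_saResolution (b : C.sa) (x : ℝ) :
    IsClopen {l : C.spectrum | val l (saResolution b x) = 0} := by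
  refine ⟨isClosed_singleton.preimage (continuous_val _), ?_⟩
  -- The only possible values are `0` and `1`, so vanishing means being below `1 / 2`.
  convert (isOpen_Iio (a := (1 / 2 : ℝ))).preimage (continuous_val (saResolution b x)) using 1
  ext l
  rcases val_saResolution_eq l b x with h | h <;> simp [h]
  norm_num

theorem val_rho_saResolution_eq_zero (h : D ≤ C) {b : C.sa} {c : D.sa} (hbc : b.1 ≤ c.1) {x : ℝ}
    {l : C.spectrum} (hl : val l (saResolution b x) = 0) :
    val (rho h l) (saResolution c x) = 0 := by
  have h1 : saIncl h (saResolution c x) ≤ saResolution b x :=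
    saResolution_anti (c := saIncl h c) hbc x
  refine le_antisymm ((val_mono l h1).trans_eq hl) ?_
  rcases val_saResolution_eq (rho h l) c x with h | h <;> rw [h]
  exact zero_le_one

end Context

/-- For a family of self-adjoint elements that grows as the context shrinks, the points of the
spectral presheaf below a given context at which the family exceeds `x` form an open set. -/
theorem isOpen_setOf_lt_val (c : ∀ C : Context A, C.sa)
    (hc : ∀ {C D : Context A}, D ≤ C → (c C).1 ≤ (c D).1) (C : Context A) (x : ℝ) :
    IsOpen[(spectralPi A).top] {y | y.base ≤ C ∧ x < Context.val y.pt (c y.base)} := by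
  let := (spectralPi A).top
  refine isOpen_iff_forall_mem_open.mpr ?_
  rintro ⟨D, l⟩ ⟨hD, hl⟩
  -- Vanishing of the projection at `z` gives only `z ≤ val`, so strict room above `x` is needed.
  obtain ⟨z, hxz, hzl⟩ := exists_between hl
  let S : Subfunctor (SpectralPresheaf A) :=
    { obj := fun E => {l | E.unop ≤ C ∧
        Context.val (C := E.unop) l (Context.saResolution (c E.unop) z) = 0}
      map := by
        rintro E F i l ⟨hE, hl⟩
        have hFE : F.unop ≤ E.unop := leOfHom i.unop
        refine ⟨hFE.trans hE, ?_⟩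
        exact Context.val_rho_saResolution_eq_zero hFE (hc hFE) hl }
  have hS : IsClopenSubobject S := fun E =>
    IsClopen.inter (X := E.spectrum) ⟨isClosed_const, isOpen_const⟩
      (Context.isClopen_setOf_val_saResolution (c E) z)
  refine ⟨clopenTotal S, ?_, TopologicalSpace.isOpen_generateFrom_of_mem ⟨S, hS, rfl⟩,
    hD, Context.val_saResolution_eq_zero_of_lt hzl⟩
  rintro ⟨E, m⟩ ⟨hE, hm⟩
  exact ⟨hE, hxz.trans_le (Context.le_val_of_val_saResolution_eq_zero hm)⟩

/-- The arrow to the lower reals defined by a family of self-adjoint elements that grows as the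
context shrinks. -/
noncomputable def lowerArrow (c : ∀ C : Context A, C.sa)
    (hc : ∀ {C D : Context A}, D ≤ C → (c C).1 ≤ (c D).1) :
    SpectralPresheaf A ⟶ LowerReals (Context A) where
  app C := TypeCat.ofHom fun l =>
    ⟨fun D => Context.val (C := C.unop) l (Context.saIncl D.2 (c D.1)),
      fun _ _ h => Context.val_mono (C := C.unop) l (hc h)⟩
  naturality _ _ _ := rfl

/-- The arrow to the upper reals defined by a family of self-adjoint elements that decreases as
the context shrinks. -/
noncomputable def upperArrow (c : ∀ C : Context A, C.sa)
    (hc : ∀ {C D : Context A}, D ≤ C → (c D).1 ≤ (c C).1) :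
    SpectralPresheaf A ⟶ UpperReals (Context A) where
  app C := TypeCat.ofHom fun l =>
    ⟨fun D => Context.val (C := C.unop) l (Context.saIncl D.2 (c D.1)),
      fun _ _ h => Context.val_mono (C := C.unop) l (hc h)⟩
  naturality _ _ _ := rfl

theorem continuous_lowerArrow (c : ∀ C : Context A, C.sa)
    (hc : ∀ {C D : Context A}, D ≤ C → (c C).1 ≤ (c D).1) :
    @Continuous _ _ (spectralPi A).top (lowerPi (Context A)).top (totalMap (lowerArrow c hc)) := by
  let := (spectralPi A).top
  refine continuous_generateFrom_iff.mpr ?_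
  rintro _ ⟨C, x, rfl⟩
  exact isOpen_setOf_lt_val c hc C x

theorem continuous_upperArrow (c : ∀ C : Context A, C.sa)
    (hc : ∀ {C D : Context A}, D ≤ C → (c D).1 ≤ (c C).1) :
    @Continuous _ _ (spectralPi A).top (upperPi (Context A)).top (totalMap (upperArrow c hc)) := by
  let := (spectralPi A).top
  refine continuous_generateFrom_iff.mpr ?_
  rintro _ ⟨C, x, rfl⟩
  -- Negation turns the upper condition into the lower one, for a family that grows as the context
  -- shrinks.
  let n : ∀ C : Context A, C.sa := fun C => ⟨-(c C).1, neg_mem (c C).2.1, (c C).2.2.neg⟩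
  have h := isOpen_setOf_lt_val n (fun h => neg_le_neg (hc h)) C (-x)
  convert h using 1
  ext y
  have h1 : Context.val (C := y.base) y.pt (n y.base) = -Context.val y.pt (c y.base) :=
    Context.val_neg _ rfl
  change y.base ≤ C ∧ Context.val y.pt (c y.base) < x ↔
    y.base ≤ C ∧ -x < Context.val (C := y.base) y.pt (n y.base)
  rw [h1, neg_lt_neg_iff]

theorem pairing_eq_val {C D : Context A} (h : D ≤ C) (l : C.spectrum) (b : D.sa) :
    pairing h l b = Context.val l (Context.saIncl h b) :=
  (Context.coe_val l (Context.saIncl h b)).symm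

end Continuity

end SpectralTopos

theorem proposition3p10 {H : Type u} [NormedAddCommGroup H] [InnerProductSpace ℂ H]
    [CompleteSpace H] (A : VonNeumannAlgebra H) (a : H →L[ℂ] H) (haA : a ∈ A)
    (ha : IsSelfAdjoint a) :
    -- outer daseinisation
    ((∀ C : Context A, IsGLB (upperApprox a C) (outerDas a C)) ∧
      ∃ δo : SpectralPresheaf A ⟶ LowerReals (Context A),
        (∀ (C : Context A) (l : C.spectrum) (D : Context A) (hD : D ≤ C),
          (((δo.app (op C) l).1 ⟨D, hD⟩ : ℝ) : ℂ) = pairing hD l (outerDas a D)) ∧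
        InternallyContinuous (spectralPi A).toInternal (lowerPi (Context A)).toInternal δo ∧
        @Continuous _ _ (spectralPi A).top (lowerPi (Context A)).top (totalMap δo)) ∧
    -- inner daseinisation
    ((∀ C : Context A, IsLUB (lowerApprox a C) (innerDas a C)) ∧
      ∃ δi : SpectralPresheaf A ⟶ UpperReals (Context A),
        (∀ (C : Context A) (l : C.spectrum) (D : Context A) (hD : D ≤ C),
          (((δi.app (op C) l).1 ⟨D, hD⟩ : ℝ) : ℂ) = pairing hD l (innerDas a D)) ∧
        InternallyContinuous (spectralPi A).toInternal (upperPi (Context A)).toInternal δi ∧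
        @Continuous _ _ (spectralPi A).top (upperPi (Context A)).top (totalMap δi)) := by
  refine ⟨⟨fun C => (isLeast_outerDas ha C).isGLB, lowerArrow (outerDas a) (outerDas_anti ha),
    fun C l D hD => (pairing_eq_val hD l _).symm, ?_, continuous_lowerArrow _ _⟩,
    ⟨fun C => (isGreatest_innerDas ha C).isLUB, upperArrow (innerDas a) (innerDas_mono ha),
    fun C l D hD => (pairing_eq_val hD l _).symm, ?_, continuous_upperArrow _ _⟩⟩
  · exact internallyContinuous_of_continuous (continuous_lowerArrow _ _)
  · exact internallyContinuous_of_continuous (continuous_upperArrow _ _)
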